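/- For $h \ge 0$ let $T[h]$ be the complete rooted ternary tree of height $h$ ($T[0]$ is a single vertex, and $T[h]$ is obtained from three disjoint copies of $T[h-1]$ by adding a new root adjacent to the roots of the copies), let $P_k$ be the path on $k$ vertices, and let $T[h,k] = T[h] \,\square\, P_k$ be their Cartesian product. For a finite graph $G$ with $n$ vertices and a real number $0<\alpha<1$, a triple $(W,U_0,U_1)$ of pairwise disjoint subsets of $V(G)$ is called a *target triple* (with respect to $\alpha$) if (1) every connected component of $G[U_1]$ has more than $n^{\alpha}$ vertices; (2) every vertex of $U_0$ has a neighbour in $U_1$ and a neighbour in $W$; (3) there is no edge between $U_1$ and $W$; (4) $U_0$ is an independent set; (5) $N(U_0)\cap W$ is an independent set; (6) for distinct $u,v \in U_0$ the sets $N(u)\cap W$ and $N(v)\cap W$ are disjoint. The *rank* of the triple is $|U_0|$. **Lemma.** There are absolute constants $c>0$ and $k_0$ such that for every real $0<\alpha<1$ and every integer $k\ge k_0$ there is $h_0=h_0(\alpha,k)$ such that for every $h\ge h_0$ the following holds. For every permutation $\pi$ of $V(T[h,k])$ (a sequence listing every vertex exactly once) there are a prefix $\pi_0$ of $\pi$ and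 disjoint sets $U_0,U_1\subseteq V(T[h,k])\setminus \pi_0$ such that $(\pi_0,U_0,U_1)$ (with $\pi_0$ regarded as the set of its elements) is a target triple of $T[h,k]$ with respect to $\alpha$, of rank $$|U_0| \;\ge\; c\,(1-\alpha)\,h\,\sqrt{k}.$$ -/

import Mathlib

/-- The nodes of the complete rooted ternary tree of height `h`: words of length at most `h` over
a three-letter alphabet. The empty word is the root and the children of `w` are the words `i :: w`
(available when `w` has length less than `h`). -/
abbrev TernaryNode (h : ℕ) : Type := {w : List (Fin 3) // w.length ≤ h}

instance TernaryNode.instFinite (h : ℕ) : Finite (TernaryNode h) :=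
  List.finite_length_le (Fin 3) h

/-- The complete ternary tree `T[h]` of height `h`, as an undirected graph: two nodes are adjacent
iff one of them is a child of the other. -/
def ternaryTree (h : ℕ) : SimpleGraph (TernaryNode h) where
  Adj u v := (∃ i : Fin 3, u.1 = i :: v.1) ∨ (∃ i : Fin 3, v.1 = i :: u.1)
  symm := ⟨fun _ _ huv => huv.symm⟩
  loopless := ⟨fun u hu => by
    rcases hu with ⟨i, hi⟩ | ⟨i, hi⟩ <;> exact absurd (congrArg List.length hi) (by simp)⟩

/-- The graph `T[h,k]`: the Cartesian product of `T[h]` with the path `P_k` on `k` vertices. -/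
def treePath (h k : ℕ) : SimpleGraph (TernaryNode h × Fin k) :=
  SimpleGraph.boxProd (ternaryTree h) (SimpleGraph.pathGraph k)

/-- `π` is a permutation of the set of all elements of `V`, that is, a sequence in which every
element of `V` occurs exactly once. -/
def IsPermutationOfVertices {V : Type*} (π : List V) : Prop :=
  π.Nodup ∧ ∀ v : V, v ∈ π

/-- `(W, U₀, U₁)` is a target triple of the finite graph `G`, with respect to the exponent `α`;
here `n` is the number of vertices of `G`. The rank of the triple is `U₀.ncard`. -/
structure IsTargetTriple {V : Type*} [Finite V] (G : SimpleGraph V) (α : ℝ)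
    (W U₀ U₁ : Set V) : Prop where
  disjoint_W_U₀ : Disjoint W U₀
  disjoint_W_U₁ : Disjoint W U₁
  disjoint_U₀_U₁ : Disjoint U₀ U₁
  /-- Each connected component of `G[U₁]` has more than `n ^ α` vertices. -/
  large_components : ∀ C : (G.induce U₁).ConnectedComponent,
    (Nat.card V : ℝ) ^ α < (C.supp.ncard : ℝ)
  /-- Each vertex of `U₀` is adjacent to `U₁`. -/
  adj_U₁ : ∀ u ∈ U₀, ∃ v ∈ U₁, G.Adj u v
  /-- Each vertex of `U₀` is adjacent to `W`. -/
  adj_W : ∀ u ∈ U₀, ∃ w ∈ W, G.Adj u w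
  /-- `U₁` is not adjacent to `W`. -/
  not_adj : ∀ v ∈ U₁, ∀ w ∈ W, ¬ G.Adj v w
  /-- `U₀` is an independent set. -/
  indep_U₀ : G.IsIndepSet U₀
  /-- `N(U₀) ∩ W` is an independent set. -/
  indep_neighbors : G.IsIndepSet ((⋃ u ∈ U₀, G.neighborSet u) ∩ W)
  /-- Distinct vertices of `U₀` have no common neighbour in `W`. -/
  disjoint_neighbors : ∀ u ∈ U₀, ∀ v ∈ U₀, u ≠ v →
    Disjoint (G.neighborSet u ∩ W) (G.neighborSet v ∩ W)

/-!
Look at a prefix `W` of the permutation. The frontier consists of the vertices that are adjacent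
both to `W` and to the big part, the union of the large components that remain once `W` and its
neighbours are deleted. Degrees are at most `6` and there are no triangles, so a subset of the
frontier that is separated by distance more than `3` and contains a fixed proportion of it can
serve as `U₀`, with the big part as `U₁`; it remains to find a prefix with a large frontier.

Fix `K ≈ k / 2` and call a subtree half explored when `W` has at least `K²` vertices over it and
misses some large subtree of it. For each of the three children of a node `w`, induction gives a
time at which the subtree of the child is half explored and has many frontier vertices. Take the
second of these times, belonging to the child `b`, and let `a` and `c` be the children with the
first and the third. At that time `W` already has `K²` vertices over `a` and still misses a subtree
over `c`, whose proper subtrees lie in the big part. There are `K` vertices of `W` over `a` that lie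
either in distinct rows or in a single row, and in both cases they can be joined to the big part by
disjoint connected roads that pass through `w` and avoid the subtree of `b`. Each road meets the
frontier, so every level of the tree contributes `K` new frontier vertices.
-/

section Counting

open Function

theorem ncard_biUnion_le_mul {ι V : Type*} {t : Set ι} (ht : t.Finite) {S : ι → Set V} {n : ℕ}
    (hS : ∀ i ∈ t, (S i).ncard ≤ n) : (⋃ i ∈ t, S i).ncard ≤ t.ncard * n := by
  rw [Set.ncard_eq_toFinset_card t ht, ← smul_eq_mul]
  simpa using (Finset.set_ncard_biUnion_le ht.toFinset S).trans
    (Finset.sum_le_card_nsmul _ _ n fun i hi => hS i (ht.mem_toFinset.1 hi))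

theorem card_le_ncard_of_pairwise_disjoint {ι V : Type*} {F : Set V} (hF : F.Finite)
    {S : ι → Set V} (hS : Pairwise (Disjoint on S)) (hSF : ∀ i, (S i ∩ F).Nonempty) :
    Nat.card ι ≤ F.ncard := by
  choose g hgS hgF using hSF
  have : Finite F := hF
  refine Nat.card_le_card_of_injective (fun i => (⟨g i, hgF i⟩ : F)) fun i j hij => ?_
  have hg : g i = g j := congrArg Subtype.val hij
  by_contra hne
  exact Set.disjoint_left.1 (hS hne) (hgS i) (hg ▸ hgS j)

theorem le_ncard_image_or_exists_le_ncard_fiber {α β : Type*} (f : α → β) {S : Set α}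
    (hS : S.Finite) {n : ℕ} (hn : n ^ 2 ≤ S.ncard) :
    n ≤ (f '' S).ncard ∨ ∃ b, n ≤ {a ∈ S | f a = b}.ncard := by
  classical
  lift S to Finset α using hS
  simp only [← Finset.coe_image, Set.ncard_coe_finset] at hn ⊢
  refine or_iff_not_imp_left.2 fun hlt => ?_
  have hne : (S.image f).Nonempty := by
    refine Finset.Nonempty.image (Finset.card_pos.1 (lt_of_lt_of_le ?_ hn)) f
    exact pow_pos (Nat.zero_lt_of_lt (not_le.1 hlt)) 2
  obtain ⟨b, -, hb⟩ := Finset.exists_le_card_fiber_of_mul_le_card_of_maps_to (n := n)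
    (fun _ => Finset.mem_image_of_mem f) hne (by nlinarith)
  exact ⟨b, by rwa [← Set.ncard_coe_finset, Finset.coe_filter] at hb⟩

theorem exists_injective_monotone_comp {α β : Type*} [LinearOrder β] (f : α → β) {S : Set α}
    (hS : S.Finite) {n : ℕ} (hn : n ≤ S.ncard) :
    ∃ x : Fin n → α, Injective x ∧ Monotone (f ∘ x) ∧ ∀ i, x i ∈ S := by
  obtain ⟨T, hTS, rfl⟩ := Set.exists_subset_card_eq hn
  have : Finite T := hS.subset hTS
  let e : Fin T.ncard ≃ T := (Finite.equivFinOfCardEq (Nat.card_coe_set_eq T)).symm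
  let σ : Equiv.Perm (Fin T.ncard) := Tuple.sort fun i => f (e i)
  exact ⟨fun i => e (σ i), Subtype.val_injective.comp (e.injective.comp σ.injective),
    Tuple.monotone_sort fun i => f (e i), fun i => hTS (e (σ i)).2⟩

theorem exists_prefix_ncard_inter_eq {V : Type*} (S : Set V) (l : List V) {m : ℕ}
    (hm : m ≤ ({v | v ∈ l} ∩ S).ncard) : ∃ p, p <+: l ∧ ({v | v ∈ p} ∩ S).ncard = m := by
  induction l using List.reverseRecOn with
  | nil => exact ⟨[], List.prefix_rfl, by simp_all⟩
  | append_singleton l v ih =>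
    by_cases hml : m ≤ ({v | v ∈ l} ∩ S).ncard
    · obtain ⟨p, hp, hpm⟩ := ih hml
      exact ⟨p, hp.trans (List.prefix_append l [v]), hpm⟩
    · have hsub : {u | u ∈ l ++ [v]} ∩ S ⊆ insert v ({u | u ∈ l} ∩ S) := by
        rintro u ⟨hu, huS⟩
        rcases List.mem_append.1 hu with hul | huv
        · exact Or.inr ⟨hul, huS⟩
        · exact Or.inl (List.mem_singleton.1 huv)
      have hle := (Set.ncard_le_ncard hsub (((List.finite_toSet l).inter_of_left S).insert v)).trans
        (Set.ncard_insert_le _ _)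
      exact ⟨l ++ [v], List.prefix_rfl, by omega⟩

theorem exists_perm_isPrefix_of_le {V : Type*} {n : ℕ} {p : Fin n → List V} {l : List V}
    (hp : ∀ i, p i <+: l) :
    ∃ σ : Equiv.Perm (Fin n), ∀ {i j}, i ≤ j → p (σ i) <+: p (σ j) :=
  ⟨Tuple.sort fun i => (p i).length, fun hij => List.prefix_of_prefix_length_le (hp _) (hp _)
    (Tuple.monotone_sort (fun i => (p i).length) hij)⟩

end Counting

section Graph

open SimpleGraph

variable {V V' : Type*} {G : SimpleGraph V} {H : SimpleGraph V'}

theorem connected_induce_range (hH : H.Connected) (f : H →g G) :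
    (G.induce (Set.range f)).Connected :=
  hH.map ⟨Set.rangeFactorization f, f.map_rel⟩ Set.rangeFactorization_surjective

theorem connected_induce_prod {A : Set V} {B : Set V'} (hA : (G.induce A).Connected)
    (hB : (H.induce B).Connected) : ((G.boxProd H).induce (A ×ˢ B)).Connected := by
  let f : (G.induce A).boxProd (H.induce B) →g G.boxProd H :=
    ⟨Prod.map Subtype.val Subtype.val, fun {x y} hxy =>
      hxy.imp (And.imp id (congrArg Subtype.val)) (And.imp id (congrArg Subtype.val))⟩
  have hf : Set.range f = A ×ˢ B := by
    change Set.range (Prod.map Subtype.val Subtype.val) = _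
    rw [Set.range_prodMap, Subtype.range_coe, Subtype.range_coe]
  exact hf ▸ connected_induce_range (hA.boxProd hB) f

theorem connected_induce_uIcc_pathGraph {k : ℕ} (a b : Fin k) :
    ((pathGraph k).induce (Set.uIcc a b)).Connected := by
  have hab : (a ⊓ b).1 ≤ (a ⊔ b).1 := inf_le_sup (a := a) (b := b)
  let f : pathGraph ((a ⊔ b).1 - (a ⊓ b).1 + 1) →g pathGraph k :=
    ⟨fun i => ⟨(a ⊓ b).1 + i.1, by omega⟩, by
      intro i j
      simp only [pathGraph_adj]
      omega⟩
  have hf : Set.range f = Set.uIcc a b := by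
    ext r
    refine ⟨?_, fun ⟨har, hrb⟩ => ⟨⟨r.1 - (a ⊓ b).1, ?_⟩, Fin.ext ?_⟩⟩
    · rintro ⟨i, rfl⟩
      refine ⟨Fin.le_def.2 ?_, Fin.le_def.2 ?_⟩ <;> simp only [f, RelHom.coeFn_mk] <;> omega
    · have := Fin.le_def.1 har
      have := Fin.le_def.1 hrb
      omega
    · exact Nat.add_sub_cancel' (Fin.le_def.1 har)
  exact hf ▸ connected_induce_range (pathGraph_connected _) f

theorem ncard_neighborSet_pathGraph_le {k : ℕ} (r : Fin k) :
    ((pathGraph k).neighborSet r).ncard ≤ 2 := by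
  have hsub : Fin.val '' (pathGraph k).neighborSet r ⊆ {r.1 + 1, r.1 - 1} := by
    rintro _ ⟨t, ht, rfl⟩
    rw [mem_neighborSet, pathGraph_adj] at ht
    simp only [Set.mem_insert_iff, Set.mem_singleton_iff]
    omega
  rw [← Set.ncard_image_of_injective _ Fin.val_injective]
  exact (Set.ncard_le_ncard hsub).trans
    ((Set.ncard_insert_le _ _).trans (by rw [Set.ncard_singleton]))

theorem ncard_neighborSet_boxProd_le [Finite V] [Finite V'] {m n : ℕ}
    (hG : ∀ v, (G.neighborSet v).ncard ≤ m) (hH : ∀ v, (H.neighborSet v).ncard ≤ n) (v : V × V') :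
    ((G.boxProd H).neighborSet v).ncard ≤ m + n := by
  rw [neighborSet_boxProd]
  refine (Set.ncard_union_le _ _).trans (Nat.add_le_add ?_ ?_)
  · simpa only [Set.ncard_prod, Set.ncard_singleton, mul_one] using hG v.1
  · simpa only [Set.ncard_prod, Set.ncard_singleton, one_mul] using hH v.2

theorem ncard_ball_le [Finite V] {d : ℕ} (hd : ∀ v, (G.neighborSet v).ncard ≤ d) (v : V) (r : ℕ) :
    (G.ball v (r + 1)).ncard ≤ (d + 1) ^ r := by
  induction r with
  | zero => simp
  | succ r ih =>
    have hcover : G.ball v ((r + 1 : ℕ) + 1) ⊆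
        ⋃ u ∈ G.ball v (r + 1), insert u (G.neighborSet u) := by
      intro x hx
      have hxr : G.edist x v ≤ (r + 1 : ℕ) := ENat.lt_add_one_iff (ENat.natCast_ne_top _) |>.1 hx
      obtain ⟨p, hp⟩ := exists_walk_of_edist_ne_top (hxr.trans_lt (ENat.natCast_lt_top _)).ne
      rw [← hp, Nat.cast_le] at hxr
      simp only [Set.mem_iUnion, mem_ball]
      cases p with
      | nil => exact ⟨v, by simp, Set.mem_insert _ _⟩
      | cons hadj p =>
        refine ⟨_, ?_, Set.mem_insert_of_mem _ hadj.symm⟩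
        refine p.edist_le.trans_lt ?_
        rw [Walk.length_cons] at hxr
        exact_mod_cast hxr
    calc (G.ball v ((r + 1 : ℕ) + 1)).ncard
        ≤ (G.ball v (r + 1)).ncard * (d + 1) :=
          (Set.ncard_le_ncard hcover).trans (ncard_biUnion_le_mul (Set.toFinite _) fun u _ =>
            (Set.ncard_insert_le _ _).trans (Nat.add_le_add_right (hd u) 1))
      _ ≤ (d + 1) ^ (r + 1) := Nat.mul_le_mul_right _ ih

theorem exists_edist_separated_subset [Finite V] {d : ℕ} (hd : ∀ v, (G.neighborSet v).ncard ≤ d)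
    (r : ℕ) (B : Set V) : ∃ U ⊆ B, U.Pairwise (fun u v => ¬ G.edist u v ≤ r) ∧
      B.ncard ≤ (d + 1) ^ r * U.ncard := by
  let R : SetRel V V := {p | G.edist p.1 p.2 ≤ r}
  have : R.IsRefl := ⟨fun v => by simp [R]⟩
  have : R.IsSymm := ⟨fun u v h => by rwa [Set.mem_ofPred_eq, edist_comm]⟩
  obtain ⟨U, hU⟩ := (Set.toFinite {U | U ⊆ B ∧ R.IsSeparated U}).exists_maximal
    ⟨∅, Set.empty_subset B, .empty⟩
  refine ⟨U, hU.prop.1, hU.prop.2, ?_⟩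
  have hcover : B ⊆ ⋃ u ∈ U, G.ball u (r + 1) := by
    intro b hb
    obtain ⟨u, huU, hbu⟩ := SetRel.IsCover.of_maximal_isSeparated hU hb
    exact Set.mem_biUnion huU ((ENat.lt_add_one_iff (ENat.natCast_ne_top r)).2 hbu)
  rw [mul_comm]
  exact (Set.ncard_le_ncard hcover).trans
    (ncard_biUnion_le_mul (Set.toFinite U) fun u _ => ncard_ball_le hd u r)

/-- The set of vertices that neither belong to `W` nor have a neighbour in `W`. -/
def awayFrom (G : SimpleGraph V) (W : Set V) : Set V :=
  {x | x ∉ W ∧ ∀ w ∈ W, ¬ G.Adj x w}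

/-- The union of the connected sets of more than `s` vertices that avoid `W` and its neighbours,
hence the union of all components with more than `s` vertices of the graph induced on
`awayFrom G W`. It serves as the set `U₁` of a target triple. -/
def bigPart (G : SimpleGraph V) (W : Set V) (s : ℝ) : Set V :=
  ⋃₀ {S | (G.induce S).Connected ∧ S ⊆ awayFrom G W ∧ s < S.ncard}

/-- The vertices adjacent both to `W` and to the big part; such a vertex is never in `W`. The set
`U₀` of a target triple is chosen among them. -/
def bigFrontier (G : SimpleGraph V) (W : Set V) (s : ℝ) : Set V :=
  {u | (∃ w ∈ W, G.Adj u w) ∧ ∃ v ∈ bigPart G W s, G.Adj u v}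

variable {W : Set V} {s : ℝ}

theorem bigPart_subset_awayFrom : bigPart G W s ⊆ awayFrom G W :=
  Set.sUnion_subset fun _ hS => hS.2.1

theorem notMem_of_mem_bigFrontier {u : V} (hu : u ∈ bigFrontier G W s) : u ∉ W := by
  obtain ⟨-, v, hv, huv⟩ := hu
  exact fun huW => (bigPart_subset_awayFrom hv).2 u huW huv.symm

theorem mem_bigFrontier_of_adj [Finite V] {x y : V} (hx : x ∈ bigPart G W s)
    (hy : y ∉ bigPart G W s) (hxy : G.Adj x y) : y ∈ bigFrontier G W s := by
  refine ⟨?_, x, hx, hxy.symm⟩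
  by_contra! hyN
  obtain ⟨S, ⟨hS, hSW, hsS⟩, hxS⟩ := hx
  have hyS : y ∈ insert y S := Set.mem_insert y S
  have hyW : y ∉ W := fun hyW => (hSW hxS).2 y hyW hxy
  refine hy (Set.mem_sUnion_of_mem hyS ⟨?_, Set.insert_subset ⟨hyW, hyN⟩ hSW, ?_⟩)
  · rw [← Set.singleton_union]
    exact connected_induce_union .of_subsingleton hS.preconnected rfl hxS hxy.symm
  · exact hsS.trans_le (by exact_mod_cast Set.ncard_le_ncard (Set.subset_insert y S))

theorem inter_bigFrontier_nonempty [Finite V] {P : Set V} (hP : (G.induce P).Preconnected)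
    (hbig : (P ∩ bigPart G W s).Nonempty) (hW : (P ∩ W).Nonempty) :
    (P ∩ bigFrontier G W s).Nonempty := by
  obtain ⟨a, haP, ha⟩ := hbig
  obtain ⟨w, hwP, hw⟩ := hW
  obtain ⟨p⟩ := hP ⟨a, haP⟩ ⟨w, hwP⟩
  obtain ⟨e, -, hfst, hsnd⟩ := p.exists_boundary_dart {x | x.1 ∈ bigPart G W s} ha
    fun hwU => (bigPart_subset_awayFrom hwU).1 hw
  exact ⟨e.snd, e.snd.2, mem_bigFrontier_of_adj hfst hsnd e.adj⟩

theorem lt_ncard_supp_of_bigPart [Finite V] (C : (G.induce (bigPart G W s)).ConnectedComponent) :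
    s < (C.supp.ncard : ℝ) := by
  induction C using ConnectedComponent.ind with
  | h v =>
    obtain ⟨S, hS, hvS⟩ := v.2
    have hSU : S ⊆ bigPart G W s := Set.subset_sUnion_of_mem hS
    have hsub : S ⊆ Subtype.val '' ((G.induce (bigPart G W s)).connectedComponentMk v).supp :=
      fun x hx => ⟨⟨x, hSU hx⟩, ConnectedComponent.sound
        ((hS.1 ⟨x, hx⟩ ⟨v, hvS⟩).map (induceHomOfLE G hSU).toHom), rfl⟩
    exact hS.2.2.trans_le (by exact_mod_cast (Set.ncard_le_ncard hsub).trans Set.ncard_image_le)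

theorem exists_isTargetTriple [Finite V] {d : ℕ} (hd : ∀ v, (G.neighborSet v).ncard ≤ d)
    (hG : G.CliqueFree 3) (α : ℝ) (W : Set V) :
    ∃ U₀ U₁ : Set V, IsTargetTriple G α W U₀ U₁ ∧
      (bigFrontier G W ((Nat.card V : ℝ) ^ α)).ncard ≤ (d + 1) ^ 3 * U₀.ncard := by
  obtain ⟨U, hUF, hsep, hcard⟩ := exists_edist_separated_subset hd 3
    (bigFrontier G W ((Nat.card V : ℝ) ^ α))
  have hfar : ∀ {u v} (p : G.Walk u v), u ∈ U → v ∈ U → u ≠ v → ¬ p.length ≤ 3 :=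
    fun p hu hv huv hp => hsep hu hv huv (p.edist_le.trans (by exact_mod_cast hp))
  refine ⟨U, bigPart G W ((Nat.card V : ℝ) ^ α), ?_, hcard⟩
  constructor
  case disjoint_W_U₀ => exact Set.disjoint_right.2 fun u hu => notMem_of_mem_bigFrontier (hUF hu)
  case disjoint_W_U₁ => exact Set.disjoint_right.2 fun u hu => (bigPart_subset_awayFrom hu).1
  case disjoint_U₀_U₁ =>
    refine Set.disjoint_left.2 fun u hu huU => ?_
    obtain ⟨w, hw, huw⟩ := (hUF hu).1
    exact (bigPart_subset_awayFrom huU).2 w hw huw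
  case large_components => exact lt_ncard_supp_of_bigPart
  case adj_U₁ => exact fun u hu => (hUF hu).2
  case adj_W => exact fun u hu => (hUF hu).1
  case not_adj => exact fun v hv => (bigPart_subset_awayFrom hv).2
  case indep_U₀ => exact fun u hu v hv huv hadj => hfar hadj.toWalk hu hv huv (by simp)
  case indep_neighbors =>
    rintro w ⟨hw, -⟩ w' ⟨hw', -⟩ - hww'
    obtain ⟨u, hu, huw⟩ := Set.mem_iUnion₂.1 hw
    obtain ⟨v, hv, hvw'⟩ := Set.mem_iUnion₂.1 hw'
    rcases eq_or_ne u v with rfl | huv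
    · classical
      exact hG {u, w, w'} (is3Clique_triple_iff.2 ⟨huw, hvw', hww'⟩)
    · exact hfar (.cons huw (.cons hww' (.cons hvw'.symm .nil))) hu hv huv le_rfl
  case disjoint_neighbors =>
    refine fun u hu v hv huv => Set.disjoint_left.2 fun w huw hvw => ?_
    exact hfar (.cons huw.1 (.cons hvw.1.symm .nil)) hu hv huv (Nat.le_succ 2)

end Graph

section Tree

open Function SimpleGraph

variable {h k : ℕ}

theorem ncard_neighborSet_ternaryTree_le (v : TernaryNode h) :
    ((ternaryTree h).neighborSet v).ncard ≤ 4 := by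
  have hsub : Subtype.val '' (ternaryTree h).neighborSet v ⊆
      insert v.1.tail (Set.range fun i : Fin 3 => i :: v.1) := by
    rintro _ ⟨u, ⟨i, hi⟩ | ⟨i, hi⟩, rfl⟩
    · exact Or.inl (congrArg List.tail hi).symm
    · exact Or.inr ⟨i, hi.symm⟩
  rw [← Set.ncard_image_of_injective _ Subtype.val_injective]
  refine (Set.ncard_le_ncard hsub).trans ((Set.ncard_insert_le _ _).trans (Nat.succ_le_succ ?_))
  rw [← Set.image_univ]
  exact (Set.ncard_image_le Set.finite_univ).trans (by simp)

theorem ncard_neighborSet_treePath_le (v : TernaryNode h × Fin k) :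
    ((treePath h k).neighborSet v).ncard ≤ 6 :=
  ncard_neighborSet_boxProd_le ncard_neighborSet_ternaryTree_le ncard_neighborSet_pathGraph_le v

theorem treePath_adj {x y : TernaryNode h × Fin k} : (treePath h k).Adj x y ↔
    ((∃ i : Fin 3, x.1.1 = i :: y.1.1) ∨ (∃ i : Fin 3, y.1.1 = i :: x.1.1)) ∧ x.2 = y.2 ∨
      (x.2.1 + 1 = y.2.1 ∨ y.2.1 + 1 = x.2.1) ∧ x.1 = y.1 := by
  rw [treePath, boxProd_adj, pathGraph_adj]
  rfl

theorem cliqueFree_treePath : (treePath h k).CliqueFree 3 := by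
  let parity : (treePath h k).Coloring (ZMod 2) :=
    Coloring.mk (fun v => v.1.1.length + v.2.1) ?_
  · exact parity.colorable.cliqueFree (by simp)
  intro x y hxy
  rcases treePath_adj.1 hxy with ⟨⟨i, hi⟩ | ⟨i, hi⟩, hr⟩ | ⟨hr | hr, hw⟩
  · simp [hi, hr, add_right_comm]
  · simp [hi, hr, add_right_comm]
  · simp [hw, ← hr]
  · simp [hw, ← hr]

/-- The subtree of `T[h]` rooted at `w`, that is, the set of words that end in `w`. -/
def subtree (h : ℕ) (w : List (Fin 3)) : Set (TernaryNode h) :=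
  {u | w <:+ u.1}

theorem subtree_subset {w e : List (Fin 3)} (hwe : w <:+ e) : subtree h e ⊆ subtree h w :=
  fun _ hu => hwe.trans hu

theorem disjoint_subtree {w e : List (Fin 3)} (hne : w ≠ e) (hlen : w.length = e.length) :
    Disjoint (subtree h w) (subtree h e) :=
  Set.disjoint_left.2 fun _ hw he =>
    hne ((List.suffix_of_suffix_length_le hw he hlen.le).eq_of_length hlen)

theorem disjoint_subtree_cons {a b : Fin 3} (hab : a ≠ b) (w : List (Fin 3)) :
    Disjoint (subtree h (a :: w)) (subtree h (b :: w)) :=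
  disjoint_subtree (fun he => hab (List.cons.inj he).1) rfl

theorem pairwise_disjoint_subtree_append (q : ℕ) (w : List (Fin 3)) :
    Pairwise (Disjoint on fun u : Fin q → Fin 3 => subtree h (List.ofFn u ++ w)) :=
  fun _ _ hne => disjoint_subtree
    (fun he => hne (List.ofFn_injective (List.append_cancel_right he))) (by simp)

theorem pow_le_ncard_subtree {q : ℕ} {w : List (Fin 3)} (hq : w.length + q ≤ h) :
    3 ^ q ≤ (subtree h w).ncard := by
  have hcard := card_le_ncard_of_pairwise_disjoint (Set.toFinite (subtree h w))
    (pairwise_disjoint_subtree_append q w) fun u =>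
      ⟨⟨List.ofFn u ++ w, by simp; omega⟩, List.suffix_rfl, List.suffix_append _ _⟩
  simpa only [Nat.card_fun, Nat.card_fin] using hcard

theorem card_ternaryNode_lt (h : ℕ) : Nat.card (TernaryNode h) < 3 ^ (h + 1) := by
  let f : (Σ i : Fin (h + 1), List.Vector (Fin 3) i) → TernaryNode h :=
    fun p => ⟨p.2.1, p.2.2.trans_le (Fin.is_le p.1)⟩
  have hf : Surjective f := fun u => ⟨⟨⟨u.1.length, Nat.lt_succ_of_le u.2⟩, u.1, rfl⟩, rfl⟩
  calc Nat.card (TernaryNode h)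
      ≤ Nat.card (Σ i : Fin (h + 1), List.Vector (Fin 3) i) := Nat.card_le_card_of_surjective f hf
    _ = ∑ i ∈ Finset.range (h + 1), 3 ^ i := by
        simp [Finset.sum_range]
    _ < 3 ^ (h + 1) := Nat.geomSum_lt (by norm_num) fun i hi => Finset.mem_range.1 hi

theorem card_rpow_lt_pow_mul {α : ℝ} (hα : 0 < α) (hα' : α < 1) (hk : 0 < k) {q : ℕ}
    (hq : α * (h + 1) ≤ q) :
    (Nat.card (TernaryNode h × Fin k) : ℝ) ^ α < ((3 ^ q * k : ℕ) : ℝ) := by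
  have hk1 : (1 : ℝ) ≤ k := by exact_mod_cast hk
  have hcard : Nat.card (TernaryNode h × Fin k) < 3 ^ (h + 1) * k := by
    rw [Nat.card_prod, Nat.card_fin]
    exact Nat.mul_lt_mul_of_pos_right (card_ternaryNode_lt h) hk
  calc (Nat.card (TernaryNode h × Fin k) : ℝ) ^ α < ((3 ^ (h + 1) * k : ℕ) : ℝ) ^ α :=
        Real.rpow_lt_rpow (by positivity) (by exact_mod_cast hcard) hα
    _ = (3 : ℝ) ^ (α * (h + 1)) * (k : ℝ) ^ α := by
        push_cast
        rw [Real.mul_rpow (by positivity) (by positivity), ← Real.rpow_natCast,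
          ← Real.rpow_mul (by norm_num), mul_comm α]
        push_cast
        rfl
    _ ≤ (3 : ℝ) ^ (q : ℝ) * (k : ℝ) ^ (1 : ℝ) := by
        gcongr
        norm_num
    _ = ((3 ^ q * k : ℕ) : ℝ) := by
        rw [Real.rpow_natCast, Real.rpow_one]
        push_cast
        rfl

/-- The nodes of the path of `T[h]` from `w` to its descendant `x`. -/
def treeBranch (h : ℕ) (w x : List (Fin 3)) : Set (TernaryNode h) :=
  {u | w <:+ u.1 ∧ u.1 <:+ x}

theorem treeBranch_subset_subtree {w x : List (Fin 3)} : treeBranch h w x ⊆ subtree h w :=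
  fun _ hu => hu.1

theorem connected_induce_treeBranch {w : List (Fin 3)} {x : TernaryNode h} (hx : x ∈ subtree h w) :
    ((ternaryTree h).induce (treeBranch h w x.1)).Connected := by
  have hlen : w.length ≤ x.1.length := hx.length_le
  let f : pathGraph (x.1.length - w.length + 1) →g ternaryTree h :=
    ⟨fun i => ⟨x.1.drop i, (List.drop_suffix i.1 x.1).length_le.trans x.2⟩, by
      have hcons : ∀ i j : Fin (x.1.length - w.length + 1), i.1 + 1 = j.1 →
          ∃ a, x.1.drop i = a :: x.1.drop j := fun i j hij =>
        ⟨_, hij ▸ List.drop_eq_getElem_cons (by omega)⟩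
      exact fun {i j} hij => (pathGraph_adj.1 hij).imp (hcons i j) (hcons j i)⟩
  have hf : Set.range f = treeBranch h w x.1 := by
    ext u
    refine ⟨?_, fun ⟨hwu, hux⟩ => ⟨⟨x.1.length - u.1.length, ?_⟩, Subtype.ext ?_⟩⟩
    · rintro ⟨i, rfl⟩
      have hdrop : x.1.drop i <:+ x.1 := List.drop_suffix i.1 x.1
      refine ⟨List.suffix_of_suffix_length_le hx hdrop ?_, hdrop⟩
      exact (Nat.le_sub_of_add_le (by omega)).trans_eq List.length_drop.symm
    · have := hwu.length_le
      omega
    · exact (List.suffix_iff_eq_drop.1 hux).symm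
  exact hf ▸ connected_induce_range (pathGraph_connected _) f

theorem connected_induce_subtree {w : List (Fin 3)} (hw : w.length ≤ h) :
    ((ternaryTree h).induce (subtree h w)).Connected := by
  refine induce_connected_of_patches ⟨w, hw⟩ List.suffix_rfl fun {x} hx =>
    ⟨treeBranch h w x.1, treeBranch_subset_subtree, ⟨List.suffix_rfl, hx⟩, ⟨hx, List.suffix_rfl⟩,
      (connected_induce_treeBranch hx).preconnected _ _⟩

/-- The vertices of `T[h,k]` whose tree coordinate lies in the subtree rooted at `w`. -/
def subtreePath (h k : ℕ) (w : List (Fin 3)) : Set (TernaryNode h × Fin k) :=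
  subtree h w ×ˢ Set.univ

theorem subtreePath_subset {w e : List (Fin 3)} (hwe : w <:+ e) :
    subtreePath h k e ⊆ subtreePath h k w :=
  Set.prod_mono (subtree_subset hwe) subset_rfl

theorem subtreePath_cons_subset (i : Fin 3) (w : List (Fin 3)) :
    subtreePath h k (i :: w) ⊆ subtreePath h k w :=
  subtreePath_subset (List.suffix_cons i w)

theorem pow_mul_le_ncard_subtreePath {q : ℕ} {w : List (Fin 3)} (hq : w.length + q ≤ h) :
    3 ^ q * k ≤ (subtreePath h k w).ncard := by
  rw [subtreePath, Set.ncard_prod, Set.ncard_univ, Nat.card_fin]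
  exact Nat.mul_le_mul_right k (pow_le_ncard_subtree hq)

theorem connected_induce_subtreePath [Nonempty (Fin k)] {w : List (Fin 3)} (hw : w.length ≤ h) :
    ((treePath h k).induce (subtreePath h k w)).Connected :=
  connected_induce_prod (connected_induce_subtree hw)
    ((induceUnivIso (pathGraph k)).connected_iff.2 ⟨pathGraph_preconnected k⟩)

theorem exists_disjoint_subtreePath {q : ℕ} {w : List (Fin 3)} {W : Set (TernaryNode h × Fin k)}
    (hW : (W ∩ subtreePath h k w).ncard < 3 ^ q) :
    ∃ e, w <:+ e ∧ e.length = w.length + q ∧ Disjoint W (subtreePath h k e) := by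
  by_contra! hcon
  refine hW.not_ge ?_
  have hdisj : Pairwise (Disjoint on fun u : Fin q → Fin 3 =>
      subtreePath h k (List.ofFn u ++ w)) :=
    fun _ _ hne => Set.Disjoint.set_prod_left (pairwise_disjoint_subtree_append q w hne) _ _
  have hcard := card_le_ncard_of_pairwise_disjoint (Set.toFinite (W ∩ subtreePath h k w)) hdisj
    fun u => by
      obtain ⟨v, hvW, hv⟩ := Set.not_disjoint_iff.1
        (hcon (List.ofFn u ++ w) (List.suffix_append _ _) (by simp [add_comm]))
      exact ⟨v, hv, hvW, subtreePath_subset (List.suffix_append _ _) hv⟩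
  simpa only [Nat.card_fun, Nat.card_fin] using hcard

theorem mem_subtreePath_of_adj {i : Fin 3} {e : List (Fin 3)} {x y : TernaryNode h × Fin k}
    (hx : x ∈ subtreePath h k (i :: e)) (hxy : (treePath h k).Adj x y) :
    y ∈ subtreePath h k e := by
  have hxi : i :: e <:+ x.1.1 := hx.1
  have hxe : e <:+ x.1.1 := (List.suffix_cons i e).trans hxi
  refine ⟨?_, Set.mem_univ _⟩
  change e <:+ y.1.1
  rcases treePath_adj.1 hxy with ⟨⟨a, ha⟩ | ⟨a, ha⟩, -⟩ | ⟨-, hxy⟩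
  · rw [ha, List.suffix_cons_iff, List.cons.injEq] at hxi
    rcases hxi with ⟨-, rfl⟩ | hiy
    · exact List.suffix_rfl
    · exact (List.suffix_cons i e).trans hiy
  · exact ha ▸ hxe.trans (List.suffix_cons a _)
  · rwa [← hxy]

theorem subtreePath_cons_subset_bigPart {W : Set (TernaryNode h × Fin k)} {s : ℝ}
    {e : List (Fin 3)} {H : ℕ} (hlen : e.length + 1 + H ≤ h) (hW : Disjoint W (subtreePath h k e))
    (hs : s < ((3 ^ H * k : ℕ) : ℝ)) (i : Fin 3) :
    subtreePath h k (i :: e) ⊆ bigPart (treePath h k) W s := by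
  intro v hv
  have : Nonempty (Fin k) := ⟨v.2⟩
  refine Set.mem_sUnion_of_mem hv ⟨connected_induce_subtreePath ?_, fun x hx => ?_, ?_⟩
  · rw [List.length_cons]
    omega
  · exact ⟨Set.disjoint_right.1 hW (subtreePath_cons_subset i e hx),
      fun w hwW hxw => Set.disjoint_left.1 hW hwW (mem_subtreePath_of_adj hx hxw)⟩
  · exact hs.trans_le (by exact_mod_cast pow_mul_le_ncard_subtreePath hlen)

/-- The road from `(x, r)` to `(d, t)` by way of the common ancestor `w` of `x` and `d`: it follows
the column of `x` from row `r` to row `t`, and then the tree within row `t`, up to `w` and down to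
`d`. -/
def road (w : List (Fin 3)) (x d : TernaryNode h) (r t : Fin k) : Set (TernaryNode h × Fin k) :=
  {x} ×ˢ Set.uIcc r t ∪ (treeBranch h w x.1 ∪ treeBranch h w d.1) ×ˢ {t}

variable {w : List (Fin 3)} {x y d : TernaryNode h} {a b c : Fin 3}

theorem left_mem_road (r t : Fin k) : (x, r) ∈ road w x d r t :=
  Or.inl ⟨rfl, Set.left_mem_uIcc⟩

theorem right_mem_road (hd : d ∈ subtree h w) (r t : Fin k) : (d, t) ∈ road w x d r t :=
  Or.inr ⟨Or.inr ⟨hd, List.suffix_rfl⟩, rfl⟩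

theorem connected_induce_road (hx : x ∈ subtree h w) (hd : d ∈ subtree h w) (r t : Fin k) :
    ((treePath h k).induce (road w x d r t)).Connected := by
  have hcolumn : ((treePath h k).induce ({x} ×ˢ Set.uIcc r t)).Connected :=
    connected_induce_prod ⟨.of_subsingleton⟩ (connected_induce_uIcc_pathGraph r t)
  have hbranches : ((ternaryTree h).induce
      (treeBranch h w x.1 ∪ treeBranch h w d.1)).Connected :=
    induce_union_connected (connected_induce_treeBranch hx).preconnected
      (connected_induce_treeBranch hd).preconnected
      ⟨⟨w, hx.length_le.trans x.2⟩, ⟨List.suffix_rfl, hx⟩, List.suffix_rfl, hd⟩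
  have hrow : ((treePath h k).induce
      ((treeBranch h w x.1 ∪ treeBranch h w d.1) ×ˢ {t})).Connected :=
    connected_induce_prod hbranches ⟨.of_subsingleton⟩
  exact induce_union_connected hcolumn.preconnected hrow.preconnected
    ⟨(x, t), ⟨rfl, Set.right_mem_uIcc⟩, Or.inl ⟨hx, List.suffix_rfl⟩, rfl⟩

theorem treeBranch_subset_sdiff (hab : a ≠ b) (hx : x ∈ subtree h (a :: w)) :
    treeBranch h w x.1 ⊆ subtree h w \ subtree h (b :: w) :=
  fun _ hu => ⟨hu.1, fun hub =>
    Set.disjoint_left.1 (disjoint_subtree_cons hab w) hx (List.IsSuffix.trans hub hu.2)⟩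

theorem road_subset (hab : a ≠ b) (hcb : c ≠ b) (hx : x ∈ subtree h (a :: w))
    (hd : d ∈ subtree h (c :: w)) (r t : Fin k) :
    road w x d r t ⊆ subtreePath h k w \ subtreePath h k (b :: w) := by
  have hxw : x ∈ subtree h w := subtree_subset (List.suffix_cons a w) hx
  have hxb := treeBranch_subset_sdiff hab hx
  have hdb := treeBranch_subset_sdiff hcb hd
  have hcolumns : subtreePath h k w \ subtreePath h k (b :: w) =
      (subtree h w \ subtree h (b :: w)) ×ˢ Set.univ := by
    simp only [subtreePath, Set.prod_univ, Set.preimage_sdiff]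
  rw [hcolumns]
  exact Set.union_subset
    (Set.prod_mono (Set.singleton_subset_iff.2 (hxb ⟨hxw, List.suffix_rfl⟩)) (Set.subset_univ _))
    (Set.prod_mono (Set.union_subset hxb hdb) (Set.subset_univ _))

theorem snd_mem_uIcc_of_mem_road {r t : Fin k} {v : TernaryNode h × Fin k}
    (hv : v ∈ road w x d r t) : v.2 ∈ Set.uIcc r t := by
  rcases hv with hv | hv
  · exact hv.2
  · exact hv.2 ▸ Set.right_mem_uIcc

theorem disjoint_road_of_ne {d' : TernaryNode h} {r t : Fin k} (hrt : r ≠ t) :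
    Disjoint (road w x d r r) (road w y d' t t) := by
  refine Set.disjoint_left.2 fun v hx hy => hrt ?_
  have hvr := snd_mem_uIcc_of_mem_road hx
  have hvt := snd_mem_uIcc_of_mem_road hy
  rw [Set.uIcc_self] at hvr hvt
  exact hvr.symm.trans hvt

theorem disjoint_road_of_length_le (hac : a ≠ c) (hy : y ∈ subtree h (a :: w))
    (hd : d ∈ subtree h (c :: w)) (hxy : x ≠ y) (hlen : x.1.length ≤ y.1.length) {r t t' : Fin k}
    (ht' : t' ∉ Set.uIcc r t) : Disjoint (road w x d r t) (road w y d r t') := by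
  refine Set.disjoint_left.2 fun v hvx hvy => ?_
  rcases hvy with ⟨hvy, -⟩ | ⟨-, hvt⟩
  · obtain rfl : v.1 = y := hvy
    rcases hvx with ⟨hvx, -⟩ | ⟨⟨-, hvx⟩ | ⟨-, hvd⟩, -⟩
    · exact hxy hvx.symm
    · exact hxy (Subtype.ext (hvx.eq_of_length (hvx.length_le.antisymm hlen)).symm)
    · exact Set.disjoint_left.1 (disjoint_subtree_cons hac w) (hy.trans hvd) hd
  · exact ht' (Set.mem_singleton_iff.1 hvt ▸ snd_mem_uIcc_of_mem_road hvx)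

theorem exists_receding_rows {K : ℕ} (hK : 2 * K ≤ k + 1) (r : Fin k) :
    ∃ t : Fin K → Fin k, ∀ i j, i < j → t j ∉ Set.uIcc r (t i) := by
  by_cases hrK : r.1 + K ≤ k
  · refine ⟨fun i => ⟨r.1 + i.1, by omega⟩, fun i j hij => ?_⟩
    rw [Set.uIcc_of_le (Fin.le_def.2 (Nat.le_add_right _ _)), Set.mem_Icc]
    simp only [Fin.le_def]
    omega
  · refine ⟨fun i => ⟨r.1 - i.1, by omega⟩, fun i j hij => ?_⟩
    rw [Set.uIcc_of_ge (Fin.le_def.2 (Nat.sub_le _ _)), Set.mem_Icc]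
    simp only [Fin.le_def]
    omega

end Tree

section Frontier

open Function

variable {h k : ℕ} {W : Set (TernaryNode h × Fin k)} {s : ℝ} {w : List (Fin 3)}
  {d : TernaryNode h} {a b c : Fin 3}

theorem card_le_ncard_bigFrontier_sdiff (hab : a ≠ b) (hcb : c ≠ b) (hd : d ∈ subtree h (c :: w))
    (hdbig : ∀ t, (d, t) ∈ bigPart (treePath h k) W s) {ι : Type*} {x : ι → TernaryNode h}
    {r t : ι → Fin k} (hx : ∀ i, (x i, r i) ∈ W ∩ subtreePath h k (a :: w))
    (hroads : Pairwise (Disjoint on fun i => road w (x i) d (r i) (t i))) :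
    Nat.card ι ≤ (bigFrontier (treePath h k) W s ∩
      (subtreePath h k w \ subtreePath h k (b :: w))).ncard := by
  refine card_le_ncard_of_pairwise_disjoint (Set.toFinite _) hroads fun i => ?_
  have hxw : x i ∈ subtree h w := subtree_subset (List.suffix_cons a w) (hx i).2.1
  have hdw : d ∈ subtree h w := subtree_subset (List.suffix_cons c w) hd
  obtain ⟨u, hu, huF⟩ := inter_bigFrontier_nonempty
    (connected_induce_road hxw hdw (r i) (t i)).preconnected
    ⟨(d, t i), right_mem_road hdw _ _, hdbig _⟩ ⟨(x i, r i), left_mem_road _ _, (hx i).1⟩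
  exact ⟨u, hu, huF, road_subset hab hcb (hx i).2.1 hd _ _ hu⟩

theorem ncard_image_snd_le_ncard_bigFrontier_sdiff (hab : a ≠ b) (hcb : c ≠ b)
    (hd : d ∈ subtree h (c :: w)) (hdbig : ∀ t, (d, t) ∈ bigPart (treePath h k) W s) :
    (Prod.snd '' (W ∩ subtreePath h k (a :: w))).ncard ≤ (bigFrontier (treePath h k) W s ∩
      (subtreePath h k w \ subtreePath h k (b :: w))).ncard := by
  choose v hv hvr using fun r : Prod.snd '' (W ∩ subtreePath h k (a :: w)) => r.2
  rw [← Nat.card_coe_set_eq]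
  exact card_le_ncard_bigFrontier_sdiff hab hcb hd hdbig (t := fun r => (v r).2) hv
    fun r r' hne => disjoint_road_of_ne fun heq =>
      hne (Subtype.ext ((hvr r).symm.trans (heq.trans (hvr r'))))

theorem le_ncard_bigFrontier_sdiff_of_row {K : ℕ} (hK : 2 * K ≤ k + 1) (hab : a ≠ b) (hcb : c ≠ b)
    (hac : a ≠ c) (hd : d ∈ subtree h (c :: w))
    (hdbig : ∀ t, (d, t) ∈ bigPart (treePath h k) W s) {r : Fin k}
    (hr : K ≤ {v ∈ W ∩ subtreePath h k (a :: w) | v.2 = r}.ncard) :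
    K ≤ (bigFrontier (treePath h k) W s ∩
      (subtreePath h k w \ subtreePath h k (b :: w))).ncard := by
  -- The deeper a starting point, the further its road recedes before it turns into the tree.
  obtain ⟨v, hvinj, hvmono, hv⟩ :=
    exists_injective_monotone_comp (fun v => v.1.1.length) (Set.toFinite _) hr
  obtain ⟨t, ht⟩ := exists_receding_rows hK r
  have hvr : ∀ i, ((v i).1, r) = v i := fun i => Prod.ext rfl (hv i).2.symm
  have hroads : Pairwise (Disjoint on fun i => road w (v i).1 d r (t i)) := by
    refine (pairwise_disjoint_on _).2 fun i j hij => ?_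
    refine disjoint_road_of_length_le hac (hv j).1.2.1 hd (fun heq => hij.ne (hvinj ?_))
      (hvmono hij.le) (ht i j hij)
    rw [← hvr i, ← hvr j, heq]
  simpa only [Nat.card_fin] using card_le_ncard_bigFrontier_sdiff hab hcb hd hdbig
    (fun i => (hvr i).symm ▸ (hv i).1) hroads

theorem le_ncard_bigFrontier_sdiff_of_sq_le {K : ℕ} (hK : 2 * K ≤ k + 1) (hab : a ≠ b) (hcb : c ≠ b)
    (hac : a ≠ c) (hd : d ∈ subtree h (c :: w))
    (hdbig : ∀ t, (d, t) ∈ bigPart (treePath h k) W s)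
    (hW : K ^ 2 ≤ (W ∩ subtreePath h k (a :: w)).ncard) :
    K ≤ (bigFrontier (treePath h k) W s ∩
      (subtreePath h k w \ subtreePath h k (b :: w))).ncard := by
  rcases le_ncard_image_or_exists_le_ncard_fiber Prod.snd (Set.toFinite _) hW with hrows | ⟨r, hr⟩
  · exact hrows.trans (ncard_image_snd_le_ncard_bigFrontier_sdiff hab hcb hd hdbig)
  · exact le_ncard_bigFrontier_sdiff_of_row hK hab hcb hac hd hdbig hr

/-- The vertex set `W` has at least `m` vertices over the subtree rooted at `w`, but misses the
subtree of height at least `H + 1` rooted at some descendant of `w`. -/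
structure IsHalfExplored (m H : ℕ) (W : Set (TernaryNode h × Fin k)) (w : List (Fin 3)) : Prop where
  le_ncard : m ≤ (W ∩ subtreePath h k w).ncard
  exists_disjoint : ∃ e, w <:+ e ∧ e.length + 1 + H ≤ h ∧ Disjoint W (subtreePath h k e)

theorem IsHalfExplored.of_cons {m H : ℕ} {i : Fin 3} (hW : IsHalfExplored m H W (i :: w)) :
    IsHalfExplored m H W w := by
  obtain ⟨e, hie, hlen, he⟩ := hW.exists_disjoint
  exact ⟨hW.le_ncard.trans (Set.ncard_le_ncard
    (Set.inter_subset_inter_right W (subtreePath_cons_subset i w))),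
    e, (List.suffix_cons i w).trans hie, hlen, he⟩

theorem IsHalfExplored.le_ncard_bigFrontier_sdiff {K H : ℕ} {W₁ W₂ : Set (TernaryNode h × Fin k)}
    (hab : a ≠ b) (hcb : c ≠ b) (hac : a ≠ c) (ha : IsHalfExplored (K ^ 2) H W₁ (a :: w))
    (hc : IsHalfExplored (K ^ 2) H W₂ (c :: w)) (hW₁ : W₁ ⊆ W) (hW₂ : W ⊆ W₂)
    (hK : 2 * K ≤ k + 1) (hs : s < ((3 ^ H * k : ℕ) : ℝ)) :
    K ≤ (bigFrontier (treePath h k) W s ∩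
      (subtreePath h k w \ subtreePath h k (b :: w))).ncard := by
  obtain ⟨e, hce, hlen, he⟩ := hc.exists_disjoint
  have hlen' : (0 :: e).length ≤ h := by rw [List.length_cons]; omega
  have hbig := subtreePath_cons_subset_bigPart hlen (he.mono_left hW₂) hs 0
  exact le_ncard_bigFrontier_sdiff_of_sq_le (d := ⟨0 :: e, hlen'⟩) hK hab hcb hac
    (hce.trans (List.suffix_cons 0 e)) (fun t => hbig ⟨List.suffix_rfl, Set.mem_univ t⟩)
    (ha.le_ncard.trans (Set.ncard_le_ncard (Set.inter_subset_inter_left _ hW₁)))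

theorem exists_prefix_isHalfExplored {m q H : ℕ} (hk : 0 < k) (hm : m < 3 ^ q)
    (hlen : w.length + (q + 1 + H) ≤ h) {π : List (TernaryNode h × Fin k)} (hπ : ∀ v, v ∈ π) :
    ∃ p, p <+: π ∧ IsHalfExplored m H {v | v ∈ p} w := by
  have hmem : {v | v ∈ π} = Set.univ := Set.eq_univ_of_forall hπ
  have hcard : m ≤ ({v | v ∈ π} ∩ subtreePath h k w).ncard := by
    rw [hmem, Set.univ_inter]
    exact (hm.le.trans (Nat.le_mul_of_pos_right _ hk)).trans
      (pow_mul_le_ncard_subtreePath (by omega))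
  obtain ⟨p, hp, hpm⟩ := exists_prefix_ncard_inter_eq _ π hcard
  obtain ⟨e, hwe, he, hdisj⟩ := exists_disjoint_subtreePath (hpm.trans_lt hm)
  exact ⟨p, hp, hpm.ge, e, hwe, by omega, hdisj⟩

theorem exists_prefix_mul_le_ncard_bigFrontier {K q H : ℕ} (hK : 2 * K ≤ k + 1) (hk : 0 < k)
    (hq : K ^ 2 < 3 ^ q) (hs : s < ((3 ^ H * k : ℕ) : ℝ)) {π : List (TernaryNode h × Fin k)}
    (hπ : ∀ v, v ∈ π) (j : ℕ) (w : List (Fin 3)) (hw : w.length + (q + 1 + H) + j ≤ h) :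
    ∃ p, p <+: π ∧ IsHalfExplored (K ^ 2) H {v | v ∈ p} w ∧
      j * K ≤ (bigFrontier (treePath h k) {v | v ∈ p} s ∩ subtreePath h k w).ncard := by
  induction j generalizing w with
  | zero =>
    obtain ⟨p, hp, hpw⟩ := exists_prefix_isHalfExplored hk hq hw hπ
    exact ⟨p, hp, hpw, by simp⟩
  | succ j ih =>
    choose p hpπ hp hpF using fun i : Fin 3 => ih (i :: w) (by rw [List.length_cons]; omega)
    obtain ⟨σ, hσ⟩ := exists_perm_isPrefix_of_le hpπ
    set F := bigFrontier (treePath h k) {v | v ∈ p (σ 1)} s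
    have hnew : K ≤ (F ∩ (subtreePath h k w \ subtreePath h k (σ 1 :: w))).ncard :=
      (hp (σ 0)).le_ncard_bigFrontier_sdiff (σ.injective.ne (by decide))
        (σ.injective.ne (by decide)) (σ.injective.ne (by decide)) (hp (σ 2))
        (hσ (by decide)).subset (hσ (by decide)).subset hK hs
    refine ⟨p (σ 1), hpπ _, (hp _).of_cons, ?_⟩
    calc (j + 1) * K = j * K + K := by ring
      _ ≤ (F ∩ subtreePath h k (σ 1 :: w)).ncard +
          (F ∩ (subtreePath h k w \ subtreePath h k (σ 1 :: w))).ncard :=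
        Nat.add_le_add (hpF (σ 1)) hnew
      _ = (F ∩ subtreePath h k w).ncard := by
        rw [← Set.ncard_union_eq (Set.disjoint_sdiff_right.mono Set.inter_subset_right
          Set.inter_subset_right), ← Set.inter_union_distrib_left,
          Set.union_sdiff_cancel (subtreePath_cons_subset _ w)]

end Frontier

theorem exists_height_split {α : ℝ} (hα : 0 < α) (hα' : α < 1) (q : ℕ) :
    ∃ h₀ : ℕ, ∀ h ≥ h₀, ∃ H j : ℕ, α * (h + 1) ≤ H ∧ q + 1 + H + j = h ∧
      (1 - α) * h ≤ 2 * j := by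
  refine ⟨⌈2 * ((q : ℝ) + 3) / (1 - α)⌉₊, fun h hh => ?_⟩
  have hpos : 0 < 1 - α := sub_pos.2 hα'
  have hlarge : 2 * ((q : ℝ) + 3) ≤ h * (1 - α) := (div_le_iff₀ hpos).1 (Nat.ceil_le.1 hh)
  have hceil : (⌈α * ((h : ℝ) + 1)⌉₊ : ℝ) < α * (h + 1) + 1 :=
    Nat.ceil_lt_add_one (by positivity)
  have hle : q + 1 + ⌈α * ((h : ℝ) + 1)⌉₊ ≤ h := by
    rify
    linarith
  obtain ⟨j, hj⟩ := Nat.exists_eq_add_of_le hle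
  refine ⟨_, j, Nat.le_ceil _, hj.symm, ?_⟩
  rify at hj
  linarith

theorem mainTheorem3_general :
    ∃ c : ℝ, 0 < c ∧ ∀ α : ℝ, 0 < α → α < 1 → ∀ k : ℕ, 0 < k →
      ∃ h₀ : ℕ, ∀ h : ℕ, h₀ ≤ h →
        ∀ π : List (TernaryNode h × Fin k), (∀ v, v ∈ π) →
          ∃ π₀ : List (TernaryNode h × Fin k), π₀ <+: π ∧
            ∃ U₀ U₁ : Set (TernaryNode h × Fin k),
              IsTargetTriple (treePath h k) α {v | v ∈ π₀} U₀ U₁ ∧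
                c * (1 - α) * (h : ℝ) * (k : ℝ) ≤ (U₀.ncard : ℝ) := by
  -- `1372 = 2 * 2 * 7 ^ 3`: half of the levels and half of the rows are used, and balls of
  -- radius `3` have at most `7 ^ 3` vertices.
  refine ⟨1 / 1372, by norm_num, fun α hα hα' k hk => ?_⟩
  obtain ⟨K, hKk, hkK⟩ : ∃ K, 2 * K ≤ k + 1 ∧ k ≤ 2 * K := ⟨(k + 1) / 2, by omega, by omega⟩
  obtain ⟨h₀, hh₀⟩ := exists_height_split hα hα' (K ^ 2)
  refine ⟨h₀, fun h hh π hπ => ?_⟩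
  obtain ⟨H, j, hH, hsum, hj⟩ := hh₀ h hh
  obtain ⟨p, hpπ, -, hpF⟩ := exists_prefix_mul_le_ncard_bigFrontier hKk hk
    (Nat.lt_pow_self (by norm_num)) (card_rpow_lt_pow_mul hα hα' hk hH) hπ j [] (by simp [hsum])
  obtain ⟨U₀, U₁, hU, hcard⟩ := exists_isTargetTriple ncard_neighborSet_treePath_le
    cliqueFree_treePath α {v | v ∈ p}
  refine ⟨p, hpπ, U₀, U₁, hU, ?_⟩
  have hjK : j * K ≤ 343 * U₀.ncard :=
    (hpF.trans (Set.ncard_le_ncard Set.inter_subset_left)).trans hcard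
  have hprod : (1 - α) * h * k ≤ 2 * j * (2 * K) := by
    gcongr
    exact_mod_cast hkK
  rify at hjK
  linarith

theorem mainTheorem3 :
    ∃ c : ℝ, 0 < c ∧ ∃ k₀ : ℕ, ∀ α : ℝ, 0 < α → α < 1 → ∀ k : ℕ, k₀ ≤ k →
      ∃ h₀ : ℕ, ∀ h : ℕ, h₀ ≤ h →
        ∀ π : List (TernaryNode h × Fin k), IsPermutationOfVertices π →
          ∃ π₀ : List (TernaryNode h × Fin k), π₀ <+: π ∧
            ∃ U₀ U₁ : Set (TernaryNode h × Fin k),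
              IsTargetTriple (treePath h k) α {v | v ∈ π₀} U₀ U₁ ∧
                c * (1 - α) * (h : ℝ) * Real.sqrt (k : ℝ) ≤ (U₀.ncard : ℝ) := by
  obtain ⟨c, hc, hgeneral⟩ := mainTheorem3_general
  refine ⟨c, hc, 1, fun α hα hα' k hk => (hgeneral α hα hα' k hk).imp fun h₀ hh₀ h hh π hπ => ?_⟩
  obtain ⟨p, hp, U₀, U₁, hU, hcard⟩ := hh₀ h hh π hπ.2
  refine ⟨p, hp, U₀, U₁, hU, le_trans ?_ hcard⟩
  have : 0 ≤ 1 - α := sub_nonneg.2 hα'.le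
  gcongr
  exact Real.sqrt_le_self_iff.2 (Or.inr (by exact_mod_cast hk))
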